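/- Let $m\ge n$, let $B,\Delta B\in\mathbb C^{m\times n}$, and let $r_1,\ldots,r_k$ ($k\ge1$) be positive integers with $r_1+\cdots+r_k=n$. Suppose that for every $t\in\mathbb R$ $$B(t):=B+t\,\Delta B=W(t)\begin{bmatrix}\Sigma(t)\\0\end{bmatrix}V(t)^H,\qquad \Sigma(t)=\operatorname{diag}(\Sigma_1(t),\ldots,\Sigma_k(t)),$$ where $W(t)=[W_1(t),\ldots,W_k(t),W_{k+1}(t)]\in\mathbb C^{m\times m}$ and $V(t)=[V_1(t),\ldots,V_k(t)]\in\mathbb C^{n\times n}$ are unitary, $\Sigma_j(t)\in\mathbb C^{r_j\times r_j}$ (not necessarily diagonal), $W_j(t)\in\mathbb C^{m\times r_j}$, $V_j(t)\in\mathbb C^{n\times r_j}$ for $j\le k$, $W_{k+1}(t)\in\mathbb C^{m\times(m-n)}$, all these matrix functions are analytic in the real variable $t$, and $$W_j(t)^H\dot W_j(t)=0\quad(1\le j\le k+1),\qquad V_j(t)^H\dot V_j(t)=0\quad(1\le j\le k)\qquad\text{for all } t.$$ Let $\sigma(M)$ denote the set of singular values of a square matrix $M$ (including zero if $M$ is singular),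 let $\mathrm{Sing}^{\downarrow}(M)$ be the diagonal matrix of its singular values, with multiplicity, in nonincreasing order, and let $\|\cdot\|_2$, $\|\cdot\|_F$ be the spectral and the Frobenius norm. Put $$\rho_1(t)=\min_{i\ne 1}\ \min_{\sigma\in\sigma(\Sigma_1(t)),\ \sigma'\in\sigma(\Sigma_i(t))}|\sigma-\sigma'|,\qquad \hat\rho_1(t)=\min\{\rho_1(t),\ \min\sigma(\Sigma_1(t))\},$$ $$\rho_{1,\min}=\min_{0\le t\le1}\rho_1(t),\qquad \hat\rho_{1,\min}=\min_{0\le t\le1}\hat\rho_1(t),$$ where a minimum over an empty family is $+\infty$ (so $\rho_{1,\min}=+\infty$ if $k=1$), with the conventions $\infty\cdot 0=0$, $\infty-x=\infty$ and $x/\infty=0$ for finite $x\ge0$. Write $W_1=W_1(0)$, $\widetilde W_1=W_1(1)$, $V_1=V_1(0)$, $\widetilde V_1=V_1(1)$, $\Sigma_1=\Sigma_1(0)$, $\widetilde\Sigma_1=\Sigma_1(1)$. (i) If $\|\Delta B\|_2<\hat\rho_{1,\min}$, then $$2\|\mathrm{Sing}^{\downarrow}(\widetilde\Sigma_1)-\mathrm{Sing}^{\downarrow}(\Sigma_1)\|_F^2+\hat\rho_{1,\min}^2\|\widetilde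 W_1-W_1\|_F^2+\rho_{1,\min}^2\|\widetilde V_1-V_1\|_F^2\le\left(\frac{\hat\rho_{1,\min}}{\hat\rho_{1,\min}-\|\Delta B\|_2}\right)^2\left(\|\Delta B\,V_1\|_F^2+\|W_1^H\Delta B\|_F^2\right).$$ (ii) If $m=n$ and $\|\Delta B\|_2<\rho_{1,\min}$, then $$2\left(1-\frac{\|\Delta B\|_2}{\rho_{1,\min}}\right)^2\|\mathrm{Sing}^{\downarrow}(\widetilde\Sigma_1)-\mathrm{Sing}^{\downarrow}(\Sigma_1)\|_F^2+(\rho_{1,\min}-\|\Delta B\|_2)^2\left(\|\widetilde W_1-W_1\|_F^2+\|\widetilde V_1-V_1\|_F^2\right)\le\|\Delta B\,V_1\|_F^2+\|W_1^H\Delta B\|_F^2.$$ -/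

import Mathlib

open scoped Matrix ENNReal

noncomputable section

namespace CombinedSVD

open scoped Matrix.Norms.Frobenius in
/-- The Frobenius norm `‖M‖_F` of a complex matrix, as an (always finite) extended
nonnegative real. -/
def frobNorm {ι κ : Type*} [Fintype ι] [Fintype κ] (M : Matrix ι κ ℂ) : ℝ≥0∞ := ‖M‖ₑ

open scoped Matrix.Norms.L2Operator in
/-- The spectral norm `‖M‖₂` of a complex matrix, as an (always finite) extended
nonnegative real. -/
def specNorm {ι κ : Type*} [Fintype ι] [Fintype κ] [DecidableEq κ] (M : Matrix ι κ ℂ) :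
    ℝ≥0∞ := ‖M‖ₑ

/-- The `n` singular values of an `m × n` matrix (`n ≤ m`), with multiplicity, in nonincreasing
order. -/
def singVals {m n : ℕ} (M : Matrix (Fin m) (Fin n) ℂ) (p : Fin n) : ℝ :=
  (Matrix.toEuclideanLin M).singularValues p

/-- `Sing↓(M)`: the diagonal matrix of the singular values in nonincreasing order. -/
def singDown {m n : ℕ} (M : Matrix (Fin m) (Fin n) ℂ) : Matrix (Fin n) (Fin n) ℂ :=
  Matrix.diagonal fun p => (singVals M p : ℂ)

/-- A matrix-valued function of a real variable is (real-)analytic on all of `ℝ`. -/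
def IsAnalytic {ι κ : Type*} (F : ℝ → Matrix ι κ ℂ) : Prop :=
  ∀ a b, AnalyticOnNhd ℝ (fun t => F t a b) Set.univ

/-- The entrywise derivative `dF/dt`. -/
def matDeriv {ι κ : Type*} (F : ℝ → Matrix ι κ ℂ) (t : ℝ) : Matrix ι κ ℂ :=
  Matrix.of fun a b => deriv (fun s => F s a b) t

/-- The block row `[X_1, …, X_k]`, with columns indexed by pairs (block, column in the block). -/
def blockRow {m k : ℕ} {r : Fin k → ℕ} (X : (j : Fin k) → Matrix (Fin m) (Fin (r j)) ℂ) :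
    Matrix (Fin m) ((j : Fin k) × Fin (r j)) ℂ :=
  Matrix.of fun a p => X p.1 a p.2

/-- A possibly rectangularly indexed complex matrix is unitary. -/
def IsUnitaryMatrix {ι κ : Type*} [Fintype ι] [Fintype κ] [DecidableEq ι] [DecidableEq κ]
    (U : Matrix ι κ ℂ) : Prop :=
  Uᴴ * U = 1 ∧ U * Uᴴ = 1

/-- The analytic decomposition
`B + t ΔB = W(t) [Σ(t); 0] V(t)ᴴ`, `Σ(t) = diag(Σ_1(t), …, Σ_k(t))`, for all real `t`, with
`W(t) = [W_1(t), …, W_k(t), W_{k+1}(t)]` and `V(t) = [V_1(t), …, V_k(t)]` unitary, everything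
analytic, and `W_j(t)ᴴ Ẇ_j(t) = 0` for `j ≤ k + 1`, `V_j(t)ᴴ V̇_j(t) = 0` for `j ≤ k`.
Here `W j, S j, V j` are the blocks `W_{j+1}, Σ_{j+1}, V_{j+1}`, and `W'` is the last block
`W_{k+1}`. -/
structure IsAnalyticDecomposition {m n k : ℕ} (r : Fin k → ℕ)
    (B ΔB : Matrix (Fin m) (Fin n) ℂ)
    (W : (j : Fin k) → ℝ → Matrix (Fin m) (Fin (r j)) ℂ)
    (W' : ℝ → Matrix (Fin m) (Fin (m - n)) ℂ)
    (S : (j : Fin k) → ℝ → Matrix (Fin (r j)) (Fin (r j)) ℂ)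
    (V : (j : Fin k) → ℝ → Matrix (Fin n) (Fin (r j)) ℂ) : Prop where
  analytic_W : ∀ j, IsAnalytic (W j)
  analytic_W' : IsAnalytic W'
  analytic_S : ∀ j, IsAnalytic (S j)
  analytic_V : ∀ j, IsAnalytic (V j)
  unitary_W : ∀ t, IsUnitaryMatrix (Matrix.fromCols (blockRow fun j => W j t) (W' t))
  unitary_V : ∀ t, IsUnitaryMatrix (blockRow fun j => V j t)
  decomposition : ∀ t : ℝ,
    B + (t : ℂ) • ΔB =
      Matrix.fromCols (blockRow fun j => W j t) (W' t) *
        (Matrix.fromRows (Matrix.blockDiagonal' fun j => S j t)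
          (0 : Matrix (Fin (m - n)) ((j : Fin k) × Fin (r j)) ℂ)) *
        (blockRow fun j => V j t)ᴴ
  normal_W : ∀ j t, (W j t)ᴴ * matDeriv (W j) t = 0
  normal_W' : ∀ t, (W' t)ᴴ * matDeriv W' t = 0
  normal_V : ∀ j t, (V j t)ᴴ * matDeriv (V j) t = 0

section Gaps

variable {k : ℕ} {r : Fin k → ℕ} (S : (j : Fin k) → ℝ → Matrix (Fin (r j)) (Fin (r j)) ℂ)

/-- `ρ_{ji}(t)`, the distance between the singular values of `Σ_j(t)` and those of `Σ_i(t)`.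
Minima are taken in `[0, ∞]`, so the minimum over an empty family is `∞`. -/
def rhoPair (j i : Fin k) (t : ℝ) : ℝ≥0∞ :=
  ⨅ p : Fin (r j), ⨅ q : Fin (r i), ENNReal.ofReal |singVals (S j t) p - singVals (S i t) q|

/-- `ρ_j(t) = min_{i ≠ j} ρ_{ji}(t)` (which is `∞` when `k = 1`). -/
def rho (j : Fin k) (t : ℝ) : ℝ≥0∞ := ⨅ i : Fin k, ⨅ _ : i ≠ j, rhoPair S j i t

/-- `σ_{j,min}(t)`, the smallest singular value of `Σ_j(t)`. -/
def sigmaMin (j : Fin k) (t : ℝ) : ℝ≥0∞ := ⨅ p : Fin (r j), ENNReal.ofReal (singVals (S j t) p)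

/-- `ρ̂_j(t) = min {ρ_j(t), σ_{j,min}(t)}`. -/
def rhoHat (j : Fin k) (t : ℝ) : ℝ≥0∞ := min (rho S j t) (sigmaMin S j t)

/-- `ρ_{j,min} = min_{0 ≤ t ≤ 1} ρ_j(t)`. -/
def rhoMin (j : Fin k) : ℝ≥0∞ := ⨅ t ∈ Set.Icc (0 : ℝ) 1, rho S j t

/-- `ρ̂_{j,min} = min_{0 ≤ t ≤ 1} ρ̂_j(t)`. -/
def rhoHatMin (j : Fin k) : ℝ≥0∞ := ⨅ t ∈ Set.Icc (0 : ℝ) 1, rhoHat S j t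

end Gaps

end CombinedSVD

end

noncomputable section

namespace CombinedSVD

/-! Write `x = ‖ΔB‖₂`, fix a block `j`, and differentiate `B(t) V_j = W_j Σ_j` and its adjoint
counterpart `B(t)ᴴ W_j = V_j Σ_jᴴ`. Projecting on the unitary frames `W(t)` and `V(t)` splits the
result. In block `i ≠ j` the pair `W_iᴴ Ẇ_j`, `V_iᴴ V̇_j` solves a coupled Sylvester system, bounded
below by the singular value gap (`gap_sq_mul_frobSq_le`). In block `j` the normalization leaves only
`Σ̇_j`, seen once from each side. In the last block `W'ᴴ Ẇ_j` is multiplied by `Σ_j`, bounded below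
by its least singular value. Summing squares, for constants `c ≤ d` below these bounds, `2‖Σ̇_j‖² +
c²‖Ẇ_j‖² + d²‖V̇_j‖² ≤ ‖ΔB V_j‖² + ‖ΔBᴴ W_j‖²` (`speed_sq_le`).

The left side is the squared speed of the curve `Z = (√2 Σ_j, c W_j, d V_j)`; the right side is
`‖H(t)‖²` with `H = (ΔB V_j, ΔBᴴ W_j)`. If `M` is the largest speed on `[0, 1]`, then `Z` moves by
at most `M` from its start, hence `H` by at most `(x/c) M`. So `M ≤ ‖H(0)‖ + (x/c) M`, and `x < c`
gives `M ≤ c/(c - x) ‖H(0)‖`, which bounds the displacement of `Z` (`displacement_sq_le`).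

Mirsky's theorem replaces `Σ_j` by its ordered singular values. Part (i) takes `c = ρ̂_min`, `d =
ρ_min`; in part (ii) the last block of `W` is empty, so `c = d = ρ_min` is allowed. Infinite gaps
are reached through arbitrarily large finite constants. -/

/-- The square of the Frobenius norm, as a real number. -/
def frobSq {ι κ : Type*} [Fintype ι] [Fintype κ] (M : Matrix ι κ ℂ) : ℝ :=
  ∑ i, ∑ j, ‖M i j‖ ^ 2

/-! ### Squared Frobenius norm and unitary invariance -/

section FrobSq

variable {ι κ l : Type*} [Fintype ι] [Fintype κ] [Fintype l]

lemma frobSq_nonneg (M : Matrix ι κ ℂ) : 0 ≤ frobSq M := by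
  unfold frobSq; positivity

lemma frobSq_conjTranspose (M : Matrix ι κ ℂ) : frobSq Mᴴ = frobSq M := by
  unfold frobSq
  rw [Finset.sum_comm]
  simp

lemma frobSq_eq_trace (M : Matrix ι κ ℂ) : (frobSq M : ℂ) = (Mᴴ * M).trace := by
  simp only [frobSq, Matrix.trace, Matrix.diag, Matrix.mul_apply, Matrix.conjTranspose_apply]
  rw [Finset.sum_comm]
  push_cast
  refine Finset.sum_congr rfl fun i _ => Finset.sum_congr rfl fun j _ => ?_
  rw [RCLike.star_def, Complex.conj_mul']

lemma frobSq_isometry_mul [DecidableEq κ] {U : Matrix ι κ ℂ} (hU : Uᴴ * U = 1)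
    (M : Matrix κ l ℂ) : frobSq (U * M) = frobSq M := by
  have : (frobSq (U * M) : ℂ) = frobSq M := by
    rw [frobSq_eq_trace, frobSq_eq_trace, Matrix.conjTranspose_mul, Matrix.mul_assoc,
      ← Matrix.mul_assoc Uᴴ, hU, Matrix.one_mul]
  exact_mod_cast this

lemma frobSq_mul_coisometry [DecidableEq κ] {U : Matrix κ ι ℂ} (hU : U * Uᴴ = 1)
    (M : Matrix l κ ℂ) : frobSq (M * U) = frobSq M := by
  rw [← frobSq_conjTranspose, Matrix.conjTranspose_mul, frobSq_isometry_mul,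
    frobSq_conjTranspose]
  simpa using hU

open scoped Matrix.Norms.Frobenius in
lemma frobNorm_sq (M : Matrix ι κ ℂ) : frobNorm M ^ 2 = ENNReal.ofReal (frobSq M) := by
  have h : ‖M‖ ^ 2 = frobSq M := by
    rw [Matrix.frobenius_norm_def, ← Real.rpow_natCast, ← Real.rpow_mul (by positivity)]
    simp [frobSq]
  rw [frobNorm, ← h, ENNReal.ofReal_pow (norm_nonneg _), ofReal_norm]

open scoped Matrix.Norms.L2Operator in
lemma frobSq_mul_le [DecidableEq κ] (A : Matrix ι κ ℂ) (M : Matrix κ l ℂ) :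
    frobSq (A * M) ≤ ‖A‖ ^ 2 * frobSq M := by
  unfold frobSq
  -- The sum is taken column by column, so that the operator norm acts on each column vector.
  rw [Finset.sum_comm, Finset.sum_comm (s := (Finset.univ : Finset κ)), Finset.mul_sum]
  refine Finset.sum_le_sum fun j _ => ?_
  have h := Matrix.l2_opNorm_mulVec A (WithLp.toLp 2 fun i => M i j)
  have h2 := pow_le_pow_left₀ (norm_nonneg _) h 2
  rw [mul_pow, EuclideanSpace.norm_sq_eq, EuclideanSpace.norm_sq_eq] at h2
  exact h2

end FrobSq

/-! ### Singular value decomposition -/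

section SVD

variable {r : ℕ}

lemma singVals_nonneg {m n : ℕ} (M : Matrix (Fin m) (Fin n) ℂ) (p : Fin n) : 0 ≤ singVals M p :=
  LinearMap.singularValues_nonneg _ _

lemma singVals_antitone {m n : ℕ} (M : Matrix (Fin m) (Fin n) ℂ) : Antitone (singVals M) :=
  fun _ _ h => LinearMap.singularValues_antitone _ h

lemma orthonormalBasis_conjTranspose_mul_self
    (u : OrthonormalBasis (Fin r) ℂ (EuclideanSpace ℂ (Fin r))) :
    (Matrix.of fun a p => u p a)ᴴ * (Matrix.of fun a p => u p a) = 1 := by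
  ext p q
  have h := orthonormal_iff_ite.mp u.orthonormal p q
  rw [Matrix.one_apply, ← h, Matrix.mul_apply, PiLp.inner_apply]
  simp [mul_comm]

/-- Singular value decomposition of a square matrix. -/
theorem exists_svd (A : Matrix (Fin r) (Fin r) ℂ) :
    ∃ U V : Matrix (Fin r) (Fin r) ℂ, Uᴴ * U = 1 ∧ Vᴴ * V = 1 ∧
      A = U * Matrix.diagonal (fun p => (singVals A p : ℂ)) * Vᴴ := by
  set T := Matrix.toEuclideanLin A with hT
  have hn : Module.finrank ℂ (EuclideanSpace ℂ (Fin r)) = r := by simp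
  set b := T.isSymmetric_adjoint_comp_self.eigenvectorBasis hn with hb
  have hin : ∀ p q, inner ℂ (T (b p)) (T (b q)) =
      if p = q then ((singVals A p : ℂ)) ^ 2 else 0 := by
    intro p q
    have h1 := T.isSymmetric_adjoint_comp_self.apply_eigenvectorBasis hn q
    rw [LinearMap.comp_apply] at h1
    rw [← LinearMap.adjoint_inner_right, ← hb] at *
    rw [h1, inner_smul_right, orthonormal_iff_ite.mp b.orthonormal p q,
      ← T.sq_singularValues_fin hn q]
    split_ifs with h
    · subst h; simp [singVals, hT]
    · simp
  -- The images of the eigenvectors of `T* T` are orthogonal with lengths the singular values. Only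
  -- the nonzero ones are normalized; the extension to a basis fills the other positions, where `T
  -- (b p) = 0` makes the choice harmless.
  have hv : Orthonormal ℂ (({p | singVals A p ≠ 0} : Set (Fin r)).domRestrict
      fun p => (singVals A p : ℂ)⁻¹ • T (b p)) := by
    rw [orthonormal_iff_ite]
    rintro ⟨p, hp⟩ ⟨q, hq⟩
    have hp' : (singVals A p : ℂ) ≠ 0 := by exact_mod_cast hp
    simp only [Set.domRestrict_apply, inner_smul_left, inner_smul_right, hin, Subtype.mk.injEq]
    split_ifs with h
    · subst h
      simp only [map_inv₀, Complex.conj_ofReal]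
      field_simp
    · simp
  obtain ⟨u, hu⟩ := hv.exists_orthonormalBasis_extension_of_card_eq (by simp)
  have key : ∀ p, T (b p) = (singVals A p : ℂ) • u p := by
    intro p
    by_cases hp : singVals A p = 0
    · have h0 := hin p p
      rw [hp] at h0 ⊢
      simpa using h0
    · have hp' : (singVals A p : ℂ) ≠ 0 := by exact_mod_cast hp
      rw [hu p hp, smul_inv_smul₀ hp']
  have hV := orthonormalBasis_conjTranspose_mul_self b
  refine ⟨Matrix.of fun a p => u p a, Matrix.of fun a p => b p a,
    orthonormalBasis_conjTranspose_mul_self u, hV, ?_⟩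
  have hAV : A * (Matrix.of fun a p => b p a) =
      (Matrix.of fun a p => u p a) * Matrix.diagonal (fun p => (singVals A p : ℂ)) := by
    ext a p
    have h := congrArg (fun x : EuclideanSpace ℂ (Fin r) => x a) (key p)
    rw [Matrix.mul_diagonal]
    simp only [PiLp.smul_apply, smul_eq_mul] at h
    rw [Matrix.of_apply, mul_comm, ← h]
    rfl
  rw [← hAV, Matrix.mul_assoc, mul_eq_one_comm.mp hV, Matrix.mul_one]

end SVD

/-! ### Mirsky's theorem -/

section DoublyStochastic

variable {r : ℕ}

/-- A rearrangement inequality for doubly stochastic matrices. -/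
lemma sum_mul_doublyStochastic_le {a b : Fin r → ℝ} (ha : Antitone a) (hb : Antitone b)
    {E : Matrix (Fin r) (Fin r) ℝ} (hE : E ∈ doublyStochastic ℝ (Fin r)) :
    ∑ p, ∑ q, a p * b q * E p q ≤ ∑ p, a p * b p := by
  -- By Birkhoff's theorem it suffices to treat permutation matrices, where this is the classical
  -- rearrangement inequality.
  obtain ⟨w, hw0, hw1, rfl⟩ := exists_eq_sum_perm_of_mem_doublyStochastic hE
  have h1 : ∀ σ : Equiv.Perm (Fin r), ∑ p, a p * b (σ p) ≤ ∑ p, a p * b p := fun σ =>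
    (ha.monovary hb).sum_mul_comp_perm_le_sum_mul
  have hperm : ∀ (σ : Equiv.Perm (Fin r)) (p q : Fin r),
      σ.permMatrix ℝ p q = if σ p = q then 1 else 0 := fun σ p q => by
    simp [Equiv.toPEquiv_apply]
  calc ∑ p, ∑ q, a p * b q * (∑ σ, w σ • σ.permMatrix ℝ) p q
      = ∑ σ, w σ * ∑ p, a p * b (σ p) := by
        simp only [Matrix.sum_apply, Matrix.smul_apply, Finset.mul_sum, smul_eq_mul, hperm]
        conv_rhs => rw [Finset.sum_comm]
        refine Finset.sum_congr rfl fun p _ => ?_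
        rw [Finset.sum_comm]
        refine Finset.sum_congr rfl fun σ _ => ?_
        rw [Finset.sum_eq_single (σ p)]
        · simp; ring
        · intro q _ hq
          simp [hq.symm]
        · simp
    _ ≤ ∑ σ, w σ * ∑ p, a p * b p :=
        Finset.sum_le_sum fun σ _ => mul_le_mul_of_nonneg_left (h1 σ) (hw0 σ)
    _ = _ := by rw [← Finset.sum_mul, hw1, one_mul]

lemma sum_norm_sq_col_of_isometry {Q : Matrix (Fin r) (Fin r) ℂ} (hQ : Qᴴ * Q = 1) (q : Fin r) :
    ∑ p, ‖Q p q‖ ^ 2 = 1 := by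
  have h := congrFun (congrFun hQ q) q
  simp only [Matrix.mul_apply, Matrix.conjTranspose_apply, RCLike.star_def, Complex.conj_mul',
    Matrix.one_apply_eq] at h
  exact_mod_cast h

lemma sum_norm_sq_row_of_isometry {Q : Matrix (Fin r) (Fin r) ℂ} (hQ : Qᴴ * Q = 1) (p : Fin r) :
    ∑ q, ‖Q p q‖ ^ 2 = 1 := by
  have := sum_norm_sq_col_of_isometry (Q := Qᴴ) (by simpa using mul_eq_one_comm.mp hQ) p
  simpa using this

/-- The two sides differ by `a b ‖x - y‖²`. -/
lemma norm_sub_sq_ge (a b : ℝ) (ha : 0 ≤ a) (hb : 0 ≤ b) (x y : ℂ) :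
    a ^ 2 * ‖x‖ ^ 2 + b ^ 2 * ‖y‖ ^ 2 - a * b * (‖x‖ ^ 2 + ‖y‖ ^ 2) ≤ ‖a * x - y * b‖ ^ 2 := by
  simp only [← Complex.normSq_eq_norm_sq, Complex.normSq_apply, Complex.sub_re, Complex.sub_im,
    Complex.mul_re, Complex.mul_im, Complex.ofReal_re, Complex.ofReal_im]
  nlinarith [mul_nonneg (mul_nonneg ha hb) (sq_nonneg (x.re - y.re)),
    mul_nonneg (mul_nonneg ha hb) (sq_nonneg (x.im - y.im))]

/-- Mirsky's theorem for the Frobenius norm. -/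
theorem sum_sq_singVals_sub_le (A B : Matrix (Fin r) (Fin r) ℂ) :
    ∑ p, (singVals A p - singVals B p) ^ 2 ≤ frobSq (A - B) := by
  obtain ⟨U₁, V₁, hU₁, hV₁, hA⟩ := exists_svd A
  obtain ⟨U₂, V₂, hU₂, hV₂, hB⟩ := exists_svd B
  set a := singVals A
  set b := singVals B
  set R := V₁ᴴ * V₂ with hRdef
  set Q := U₁ᴴ * U₂ with hQdef
  have hR : Rᴴ * R = 1 := by
    rw [hRdef, Matrix.conjTranspose_mul, Matrix.conjTranspose_conjTranspose, Matrix.mul_assoc,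
      ← Matrix.mul_assoc V₁, mul_eq_one_comm.mp hV₁, Matrix.one_mul, hV₂]
  have hQ : Qᴴ * Q = 1 := by
    rw [hQdef, Matrix.conjTranspose_mul, Matrix.conjTranspose_conjTranspose, Matrix.mul_assoc,
      ← Matrix.mul_assoc U₁, mul_eq_one_comm.mp hU₁, Matrix.one_mul, hU₂]
  -- Mixing the left frame of `A` with the right frame of `B` makes one factor of each product
  -- diagonal.
  have h1 : frobSq (A - B) = frobSq (Matrix.diagonal (fun p => (a p : ℂ)) * R
      - Q * Matrix.diagonal (fun p => (b p : ℂ))) := by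
    rw [← frobSq_isometry_mul (U := U₁ᴴ) (by simpa using mul_eq_one_comm.mp hU₁),
      ← frobSq_mul_coisometry (U := V₂) (mul_eq_one_comm.mp hV₂)]
    congr 1
    rw [Matrix.mul_sub, Matrix.sub_mul, hRdef, hQdef]
    congr 1
    · nth_rewrite 1 [hA]
      simp only [← Matrix.mul_assoc, hU₁, Matrix.one_mul]
    · nth_rewrite 1 [hB]
      simp only [Matrix.mul_assoc, hV₂, Matrix.mul_one]
  -- The squared moduli of a unitary matrix are doubly stochastic, hence so is the average of those
  -- of `R` and `Q`; the cross terms are governed by exactly this average.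
  have hE : (Matrix.of fun p q => (‖R p q‖ ^ 2 + ‖Q p q‖ ^ 2) / 2) ∈ doublyStochastic ℝ (Fin r) := by
    rw [mem_doublyStochastic_iff_sum]
    refine ⟨fun i j => ?_, fun i => ?_, fun j => ?_⟩
    · simp only [Matrix.of_apply]; positivity
    · simp only [Matrix.of_apply]
      rw [← Finset.sum_div, Finset.sum_add_distrib, sum_norm_sq_row_of_isometry hR,
        sum_norm_sq_row_of_isometry hQ]; norm_num
    · simp only [Matrix.of_apply]
      rw [← Finset.sum_div, Finset.sum_add_distrib, sum_norm_sq_col_of_isometry hR,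
        sum_norm_sq_col_of_isometry hQ]; norm_num
  have h2 := sum_mul_doublyStochastic_le (singVals_antitone A) (singVals_antitone B) hE
  have h3 : ∑ p, ∑ q, (a p ^ 2 * ‖R p q‖ ^ 2 + b q ^ 2 * ‖Q p q‖ ^ 2
      - a p * b q * (‖R p q‖ ^ 2 + ‖Q p q‖ ^ 2)) ≤ frobSq (A - B) := by
    rw [h1, frobSq]
    refine Finset.sum_le_sum fun p _ => Finset.sum_le_sum fun q _ => ?_
    rw [Matrix.sub_apply, Matrix.diagonal_mul, Matrix.mul_diagonal]
    exact norm_sub_sq_ge _ _ (singVals_nonneg A p) (singVals_nonneg B q) _ _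
  have h4 : ∑ p, ∑ q, a p ^ 2 * ‖R p q‖ ^ 2 = ∑ p, a p ^ 2 := by
    refine Finset.sum_congr rfl fun p _ => ?_
    rw [← Finset.mul_sum, sum_norm_sq_row_of_isometry hR, mul_one]
  have h5 : ∑ p, ∑ q, b q ^ 2 * ‖Q p q‖ ^ 2 = ∑ p, b p ^ 2 := by
    rw [Finset.sum_comm]
    refine Finset.sum_congr rfl fun p _ => ?_
    rw [← Finset.mul_sum, sum_norm_sq_col_of_isometry hQ, mul_one]
  have h6 : ∑ p, ∑ q, a p * b q * (‖R p q‖ ^ 2 + ‖Q p q‖ ^ 2) =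
      2 * ∑ p, ∑ q, a p * b q *
        (Matrix.of fun p q => (‖R p q‖ ^ 2 + ‖Q p q‖ ^ 2) / 2) p q := by
    simp only [Finset.mul_sum, Matrix.of_apply]
    refine Finset.sum_congr rfl fun p _ => Finset.sum_congr rfl fun q _ => by ring
  have h7 : ∑ p, (a p - b p) ^ 2 = ∑ p, a p ^ 2 + ∑ p, b p ^ 2 - 2 * ∑ p, a p * b p := by
    rw [Finset.mul_sum, ← Finset.sum_add_distrib, ← Finset.sum_sub_distrib]
    exact Finset.sum_congr rfl fun p _ => by ring
  simp only [Finset.sum_sub_distrib, Finset.sum_add_distrib, h4, h5, h6] at h3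
  rw [h7]
  linarith

lemma frobSq_singDown_sub_le (A B : Matrix (Fin r) (Fin r) ℂ) :
    frobSq (singDown A - singDown B) ≤ frobSq (A - B) := by
  refine le_trans (le_of_eq ?_) (sum_sq_singVals_sub_le A B)
  rw [frobSq]
  refine Finset.sum_congr rfl fun p _ => ?_
  rw [Finset.sum_eq_single p]
  · rw [singDown, singDown, Matrix.sub_apply, Matrix.diagonal_apply_eq, Matrix.diagonal_apply_eq,
      ← Complex.ofReal_sub, Complex.norm_real, Real.norm_eq_abs, sq_abs]
  · intro q _ hq
    simp [singDown, hq.symm]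
  · simp

end DoublyStochastic

/-! ### Lower bounds from singular value gaps -/

section Gap

variable {s r : ℕ}

/-- The right side equals `(a - c)² (‖x‖² + ‖y‖²) + 2 a c ‖x - y‖²`. This is the diagonal case of
the Sylvester bound. -/
lemma sq_mul_add_norm_sq_le {ρ a c : ℝ} (hρ : 0 ≤ ρ) (ha : 0 ≤ a) (hc : 0 ≤ c)
    (h : ρ ≤ |a - c|) (x y : ℂ) :
    ρ ^ 2 * (‖x‖ ^ 2 + ‖y‖ ^ 2) ≤ ‖x * a - c * y‖ ^ 2 + ‖y * a - c * x‖ ^ 2 := by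
  have h2 : ρ ^ 2 ≤ (a - c) ^ 2 := by
    rw [← sq_abs (a - c)]; exact pow_le_pow_left₀ hρ h 2
  refine (mul_le_mul_of_nonneg_right h2 (by positivity)).trans ?_
  simp only [← Complex.normSq_eq_norm_sq, Complex.normSq_apply, Complex.sub_re, Complex.sub_im,
    Complex.mul_re, Complex.mul_im, Complex.ofReal_re, Complex.ofReal_im]
  nlinarith [mul_nonneg (mul_nonneg ha hc) (sq_nonneg (x.re - y.re)),
    mul_nonneg (mul_nonneg ha hc) (sq_nonneg (x.im - y.im))]

/-- The coupled Sylvester operator `(X, Y) ↦ (X A - C Y, Y Aᴴ - Cᴴ X)` is bounded below by the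
gap between the singular values of `A` and those of `C`. -/
theorem gap_sq_mul_frobSq_le {ρ : ℝ} (hρ : 0 ≤ ρ) (A : Matrix (Fin r) (Fin r) ℂ)
    (C : Matrix (Fin s) (Fin s) ℂ) (h : ∀ p q, ρ ≤ |singVals A p - singVals C q|)
    (X Y : Matrix (Fin s) (Fin r) ℂ) :
    ρ ^ 2 * (frobSq X + frobSq Y) ≤ frobSq (X * A - C * Y) + frobSq (Y * Aᴴ - Cᴴ * X) := by
  obtain ⟨U₁, V₁, hU₁, hV₁, hA⟩ := exists_svd A
  obtain ⟨U₂, V₂, hU₂, hV₂, hC⟩ := exists_svd C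
  set a := singVals A
  set c := singVals C
  have hU₁' := mul_eq_one_comm.mp hU₁
  have hV₁' := mul_eq_one_comm.mp hV₁
  have hU₂' := mul_eq_one_comm.mp hU₂
  have hV₂' := mul_eq_one_comm.mp hV₂
  have hX : frobSq X = frobSq (U₂ᴴ * X * U₁) := by
    rw [frobSq_mul_coisometry hU₁', frobSq_isometry_mul (by simpa using hU₂')]
  have hY : frobSq Y = frobSq (V₂ᴴ * Y * V₁) := by
    rw [frobSq_mul_coisometry hV₁', frobSq_isometry_mul (by simpa using hV₂')]
  set D₁ := Matrix.diagonal (fun p => (a p : ℂ)) with hD₁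
  set D₂ := Matrix.diagonal (fun p => (c p : ℂ)) with hD₂
  have hD₁' : D₁ᴴ = D₁ := by
    rw [hD₁, Matrix.diagonal_conjTranspose]; congr 1; ext p; simp
  have hD₂' : D₂ᴴ = D₂ := by
    rw [hD₂, Matrix.diagonal_conjTranspose]; congr 1; ext p; simp
  have hP : frobSq (X * A - C * Y) = frobSq ((U₂ᴴ * X * U₁) * D₁ - D₂ * (V₂ᴴ * Y * V₁)) := by
    rw [← frobSq_isometry_mul (U := U₂ᴴ) (by simpa using hU₂'),
      ← frobSq_mul_coisometry (U := V₁) hV₁']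
    congr 1
    rw [Matrix.mul_sub, Matrix.sub_mul, hA, hC]
    congr 1
    · simp only [Matrix.mul_assoc, hV₁, Matrix.mul_one]
    · simp only [← Matrix.mul_assoc, hU₂, Matrix.one_mul]
  have hQ : frobSq (Y * Aᴴ - Cᴴ * X) = frobSq ((V₂ᴴ * Y * V₁) * D₁ - D₂ * (U₂ᴴ * X * U₁)) := by
    rw [← frobSq_isometry_mul (U := V₂ᴴ) (by simpa using hV₂'),
      ← frobSq_mul_coisometry (U := U₁) hU₁']
    congr 1
    rw [Matrix.mul_sub, Matrix.sub_mul, hA, hC]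
    simp only [Matrix.conjTranspose_mul, Matrix.conjTranspose_conjTranspose, hD₁', hD₂']
    congr 1
    · simp only [Matrix.mul_assoc, hU₁, Matrix.mul_one]
    · simp only [← Matrix.mul_assoc, hV₂, Matrix.one_mul]
  rw [hX, hY, hP, hQ]
  simp only [frobSq, ← Finset.sum_add_distrib, Finset.mul_sum]
  refine Finset.sum_le_sum fun q _ => Finset.sum_le_sum fun p _ => ?_
  simp only [Matrix.sub_apply, hD₁, hD₂, Matrix.diagonal_mul, Matrix.mul_diagonal]
  exact sq_mul_add_norm_sq_le hρ (singVals_nonneg A p) (singVals_nonneg C q) (h p q) _ _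

/-- Up to unitary factors, `A` scales the columns of `X` by its singular values. This controls the
component of `Ẇ_j` in the last block. -/
theorem sq_mul_frobSq_le_of_le_singVals {ι : Type*} [Fintype ι] {c : ℝ} (hc : 0 ≤ c)
    (A : Matrix (Fin r) (Fin r) ℂ) (h : ∀ p, c ≤ singVals A p) (X : Matrix ι (Fin r) ℂ) :
    c ^ 2 * frobSq X ≤ frobSq (X * A) := by
  obtain ⟨U, V, hU, hV, hA⟩ := exists_svd A
  have hX : frobSq X = frobSq (X * U) := by
    rw [frobSq_mul_coisometry (mul_eq_one_comm.mp hU)]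
  have hP : frobSq (X * A) =
      frobSq (X * U * Matrix.diagonal (fun p => (singVals A p : ℂ))) := by
    nth_rewrite 1 [hA]
    rw [← Matrix.mul_assoc, ← Matrix.mul_assoc,
      frobSq_mul_coisometry (by simpa using hV)]
  rw [hX, hP]
  simp only [frobSq, Finset.mul_sum]
  refine Finset.sum_le_sum fun i _ => Finset.sum_le_sum fun p _ => ?_
  rw [Matrix.mul_diagonal, norm_mul, mul_pow, mul_comm, Complex.norm_real, Real.norm_eq_abs,
    sq_abs]
  gcongr
  exact h p

end Gap

/-! ### Entrywise derivatives of matrix functions -/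

section MatDeriv

variable {ι κ l : Type*}

/-- `F` has the entrywise derivative `F'` at `t`. -/
def HasMatDerivAt (F : ℝ → Matrix ι κ ℂ) (F' : Matrix ι κ ℂ) (t : ℝ) : Prop :=
  ∀ a b, HasDerivAt (fun s => F s a b) (F' a b) t

lemma IsAnalytic.hasMatDerivAt {F : ℝ → Matrix ι κ ℂ} (hF : IsAnalytic F) (t : ℝ) :
    HasMatDerivAt F (matDeriv F t) t := fun a b =>
  ((hF a b) t (Set.mem_univ t)).differentiableAt.hasDerivAt

lemma IsAnalytic.continuous_matDeriv {F : ℝ → Matrix ι κ ℂ} (hF : IsAnalytic F) (a : ι) (b : κ) :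
    Continuous fun t => matDeriv F t a b :=
  continuousOn_univ.mp (hF a b).deriv.continuousOn

lemma HasMatDerivAt.mul [Fintype κ] {F : ℝ → Matrix ι κ ℂ} {G : ℝ → Matrix κ l ℂ}
    {F' : Matrix ι κ ℂ} {G' : Matrix κ l ℂ} {t : ℝ} (hF : HasMatDerivAt F F' t)
    (hG : HasMatDerivAt G G' t) :
    HasMatDerivAt (fun s => F s * G s) (F' * G t + F t * G') t := by
  intro a b
  simp only [Matrix.mul_apply, Matrix.add_apply, ← Finset.sum_add_distrib]
  exact HasDerivAt.fun_sum fun i _ => (hF a i).mul (hG i b)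

lemma HasMatDerivAt.conjTranspose {F : ℝ → Matrix ι κ ℂ} {F' : Matrix ι κ ℂ} {t : ℝ}
    (hF : HasMatDerivAt F F' t) : HasMatDerivAt (fun s => (F s)ᴴ) F'ᴴ t :=
  fun a b => (hF b a).star

lemma HasMatDerivAt.unique {F : ℝ → Matrix ι κ ℂ} {F' F'' : Matrix ι κ ℂ} {t : ℝ}
    (h : HasMatDerivAt F F' t) (h' : HasMatDerivAt F F'' t) : F' = F'' :=
  Matrix.ext fun a b => (h a b).unique (h' a b)

lemma hasMatDerivAt_add_smul (B D : Matrix ι κ ℂ) (t : ℝ) :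
    HasMatDerivAt (fun s => B + (s : ℂ) • D) D t := by
  intro a b
  simp only [Matrix.add_apply, Matrix.smul_apply, smul_eq_mul]
  have h := (Complex.ofRealCLM.hasDerivAt (x := t)).mul_const (D a b)
  simpa using h.const_add (B a b)

lemma HasMatDerivAt.fromRows {F : ℝ → Matrix ι κ ℂ} {F' : Matrix ι κ ℂ} {G : ℝ → Matrix l κ ℂ}
    {G' : Matrix l κ ℂ} {t : ℝ} (hF : HasMatDerivAt F F' t) (hG : HasMatDerivAt G G' t) :
    HasMatDerivAt (fun s => Matrix.fromRows (F s) (G s)) (Matrix.fromRows F' G') t := by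
  rintro (a | a) b
  · exact hF a b
  · exact hG a b

lemma HasMatDerivAt.const_smul {F : ℝ → Matrix ι κ ℂ} {F' : Matrix ι κ ℂ} {t : ℝ}
    (hF : HasMatDerivAt F F' t) (c : ℂ) : HasMatDerivAt (fun s => c • F s) (c • F') t :=
  fun a b => (hF a b).const_mul c

end MatDeriv

/-! ### Block rows and the Pythagorean identity -/

section Blocks

variable {m k l : ℕ} {r : Fin k → ℕ}

lemma mul_blockRow {n : ℕ} (A : Matrix (Fin n) (Fin m) ℂ)
    (X : (j : Fin k) → Matrix (Fin m) (Fin (r j)) ℂ) :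
    A * blockRow X = blockRow fun j => A * X j := rfl

lemma blockRow_injective : Function.Injective
    (blockRow : ((j : Fin k) → Matrix (Fin m) (Fin (r j)) ℂ) → _) := fun X Y h => by
  funext j
  ext a b
  exact congrFun (congrFun h a) ⟨j, b⟩

lemma blockRow_mul_blockDiagonal (X : (j : Fin k) → Matrix (Fin m) (Fin (r j)) ℂ)
    (S : (j : Fin k) → Matrix (Fin (r j)) (Fin (r j)) ℂ) :
    blockRow X * Matrix.blockDiagonal' S = blockRow fun j => X j * S j := by
  ext a ⟨j, q⟩
  rw [Matrix.mul_apply, Fintype.sum_sigma, Finset.sum_eq_single j]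
  · simp [blockRow, Matrix.mul_apply]
  · intro i _ hi
    refine Finset.sum_eq_zero fun p _ => ?_
    rw [Matrix.blockDiagonal'_apply_ne _ _ _ hi, mul_zero]
  · simp

lemma conjTranspose_mul_eq_zero_of_blockRow
    {X : (j : Fin k) → Matrix (Fin m) (Fin (r j)) ℂ}
    (h : (blockRow X)ᴴ * blockRow X = 1) {i j : Fin k} (hij : i ≠ j) : (X i)ᴴ * X j = 0 := by
  ext p q
  have := congrFun (congrFun h ⟨i, p⟩) ⟨j, q⟩
  rw [Matrix.one_apply_ne (by intro h; exact hij (congrArg Sigma.fst h))] at this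
  exact this

lemma conjTranspose_mul_eq_one_of_blockRow
    {X : (j : Fin k) → Matrix (Fin m) (Fin (r j)) ℂ}
    (h : (blockRow X)ᴴ * blockRow X = 1) (j : Fin k) : (X j)ᴴ * X j = 1 := by
  ext p q
  have := congrFun (congrFun h ⟨j, p⟩) ⟨j, q⟩
  rw [Matrix.one_apply] at this ⊢
  refine Eq.trans this ?_
  simp

lemma blockRow_of_fromCols {X : (j : Fin k) → Matrix (Fin m) (Fin (r j)) ℂ}
    {X' : Matrix (Fin m) (Fin l) ℂ} (h : IsUnitaryMatrix (Matrix.fromCols (blockRow X) X')) :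
    (blockRow X)ᴴ * blockRow X = 1 ∧ ∀ j, X'ᴴ * X j = 0 := by
  have h1 := h.1
  rw [Matrix.conjTranspose_fromCols_eq_fromRows_conjTranspose, Matrix.fromRows_mul_fromCols,
    ← Matrix.fromBlocks_one, Matrix.fromBlocks_inj] at h1
  refine ⟨h1.1, fun j => ?_⟩
  have h2 : blockRow (fun j => X'ᴴ * X j) = blockRow (fun _ => 0) := by
    rw [← mul_blockRow, h1.2.2.1]; rfl
  exact congrFun (blockRow_injective h2) j

lemma frobSq_blockRow_conjTranspose_mul {s : ℕ} (X : (j : Fin k) → Matrix (Fin m) (Fin (r j)) ℂ)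
    (Z : Matrix (Fin m) (Fin s) ℂ) :
    frobSq ((blockRow X)ᴴ * Z) = ∑ j, frobSq ((X j)ᴴ * Z) := by
  rw [frobSq, Fintype.sum_sigma]
  rfl

lemma frobSq_eq_sum_of_blockRow {s : ℕ} {X : (j : Fin k) → Matrix (Fin m) (Fin (r j)) ℂ}
    (h : IsUnitaryMatrix (blockRow X)) (Z : Matrix (Fin m) (Fin s) ℂ) :
    frobSq Z = ∑ j, frobSq ((X j)ᴴ * Z) := by
  rw [← frobSq_blockRow_conjTranspose_mul, frobSq_isometry_mul (by simpa using h.2)]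

lemma frobSq_eq_sum_of_fromCols {s : ℕ} {X : (j : Fin k) → Matrix (Fin m) (Fin (r j)) ℂ}
    {X' : Matrix (Fin m) (Fin l) ℂ} (h : IsUnitaryMatrix (Matrix.fromCols (blockRow X) X'))
    (Z : Matrix (Fin m) (Fin s) ℂ) :
    frobSq Z = ∑ j, frobSq ((X j)ᴴ * Z) + frobSq (X'ᴴ * Z) := by
  rw [← frobSq_blockRow_conjTranspose_mul,
    ← frobSq_isometry_mul (U := (Matrix.fromCols (blockRow X) X')ᴴ) (by simpa using h.2),
    Matrix.conjTranspose_fromCols_eq_fromRows_conjTranspose, Matrix.fromRows_mul, frobSq,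
    Fintype.sum_sum_type]
  rfl

end Blocks

/-! ### The differentiated decomposition and the speed estimate -/

namespace IsAnalyticDecomposition

variable {m n k : ℕ} {r : Fin k → ℕ} {B ΔB : Matrix (Fin m) (Fin n) ℂ}
  {W : (j : Fin k) → ℝ → Matrix (Fin m) (Fin (r j)) ℂ}
  {W' : ℝ → Matrix (Fin m) (Fin (m - n)) ℂ}
  {S : (j : Fin k) → ℝ → Matrix (Fin (r j)) (Fin (r j)) ℂ}
  {V : (j : Fin k) → ℝ → Matrix (Fin n) (Fin (r j)) ℂ}

lemma blockRow_W (h : IsAnalyticDecomposition r B ΔB W W' S V) (t : ℝ) :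
    (blockRow fun j => W j t)ᴴ * (blockRow fun j => W j t) = 1 :=
  (blockRow_of_fromCols (h.unitary_W t)).1

lemma W'_mul_W (h : IsAnalyticDecomposition r B ΔB W W' S V) (t : ℝ) (j : Fin k) :
    (W' t)ᴴ * W j t = 0 :=
  (blockRow_of_fromCols (h.unitary_W t)).2 j

lemma eq_blockRow_mul (h : IsAnalyticDecomposition r B ΔB W W' S V) (t : ℝ) :
    B + (t : ℂ) • ΔB = (blockRow fun j => W j t * S j t) * (blockRow fun j => V j t)ᴴ := by
  rw [h.decomposition t, Matrix.fromCols_mul_fromRows, Matrix.mul_zero, add_zero,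
    blockRow_mul_blockDiagonal]

lemma mul_V (h : IsAnalyticDecomposition r B ΔB W W' S V) (j : Fin k) (t : ℝ) :
    (B + (t : ℂ) • ΔB) * V j t = W j t * S j t := by
  have h1 : blockRow (fun j => (B + (t : ℂ) • ΔB) * V j t) = blockRow fun j => W j t * S j t := by
    rw [← mul_blockRow, h.eq_blockRow_mul t, Matrix.mul_assoc, (h.unitary_V t).1, Matrix.mul_one]
  exact congrFun (blockRow_injective h1) j

lemma W'_mul (h : IsAnalyticDecomposition r B ΔB W W' S V) (t : ℝ) :
    (W' t)ᴴ * (B + (t : ℂ) • ΔB) = 0 := by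
  rw [h.eq_blockRow_mul t, ← Matrix.mul_assoc, mul_blockRow]
  simp only [← Matrix.mul_assoc, h.W'_mul_W t, Matrix.zero_mul]
  exact Matrix.zero_mul _

/-- Both sides agree on every block of the unitary `V(t)`, by orthonormality of the two frames. The
adjoint supplies the second relation to be differentiated. -/
lemma W_mul (h : IsAnalyticDecomposition r B ΔB W W' S V) (j : Fin k) (t : ℝ) :
    (W j t)ᴴ * (B + (t : ℂ) • ΔB) = S j t * (V j t)ᴴ := by
  have h1 : (W j t)ᴴ * (B + (t : ℂ) • ΔB) * (blockRow fun j => V j t) =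
      S j t * (V j t)ᴴ * (blockRow fun j => V j t) := by
    rw [mul_blockRow, mul_blockRow]
    congr 1
    funext i
    rw [Matrix.mul_assoc, h.mul_V, Matrix.mul_assoc, ← Matrix.mul_assoc]
    by_cases hij : j = i
    · subst hij
      rw [conjTranspose_mul_eq_one_of_blockRow (h.blockRow_W t) j,
        conjTranspose_mul_eq_one_of_blockRow (h.unitary_V t).1 j, Matrix.mul_one, Matrix.one_mul]
    · rw [conjTranspose_mul_eq_zero_of_blockRow (h.blockRow_W t) hij,
        conjTranspose_mul_eq_zero_of_blockRow (h.unitary_V t).1 hij, Matrix.mul_zero,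
        Matrix.zero_mul]
  have h2 := congrArg (· * (blockRow fun j => V j t)ᴴ) h1
  simpa only [Matrix.mul_assoc, (h.unitary_V t).2, Matrix.mul_one] using h2

lemma conjTranspose_mul_W (h : IsAnalyticDecomposition r B ΔB W W' S V) (j : Fin k) (t : ℝ) :
    (B + (t : ℂ) • ΔB)ᴴ * W j t = V j t * (S j t)ᴴ := by
  have := congrArg Matrix.conjTranspose (h.W_mul j t)
  simpa [Matrix.conjTranspose_mul] using this

lemma deriv_mul_V (h : IsAnalyticDecomposition r B ΔB W W' S V) (j : Fin k) (t : ℝ) :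
    ΔB * V j t + (B + (t : ℂ) • ΔB) * matDeriv (V j) t =
      matDeriv (W j) t * S j t + W j t * matDeriv (S j) t := by
  have h1 := (hasMatDerivAt_add_smul B ΔB t).mul ((h.analytic_V j).hasMatDerivAt t)
  have h2 := ((h.analytic_W j).hasMatDerivAt t).mul ((h.analytic_S j).hasMatDerivAt t)
  simp only [h.mul_V] at h1
  exact h1.unique h2

lemma deriv_conjTranspose_mul_W (h : IsAnalyticDecomposition r B ΔB W W' S V) (j : Fin k)
    (t : ℝ) :
    ΔBᴴ * W j t + (B + (t : ℂ) • ΔB)ᴴ * matDeriv (W j) t =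
      matDeriv (V j) t * (S j t)ᴴ + V j t * (matDeriv (S j) t)ᴴ := by
  have h1 := (hasMatDerivAt_add_smul B ΔB t).conjTranspose.mul ((h.analytic_W j).hasMatDerivAt t)
  have h2 := ((h.analytic_V j).hasMatDerivAt t).mul
    ((h.analytic_S j).hasMatDerivAt t).conjTranspose
  simp only [h.conjTranspose_mul_W] at h1
  exact h1.unique h2

/-- Orthogonality of `W_i` and `W_j` removes the `Σ̇_j` term, and `W_iᴴ B(t) = Σ_i V_iᴴ` turns the
rest into one half of a coupled Sylvester system; `V_mul_ΔB_mul_W` is the other half. -/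
lemma W_mul_ΔB_mul_V (h : IsAnalyticDecomposition r B ΔB W W' S V) (i j : Fin k) (t : ℝ)
    (hij : i ≠ j) :
    (W i t)ᴴ * (ΔB * V j t) = ((W i t)ᴴ * matDeriv (W j) t) * S j t -
      S i t * ((V i t)ᴴ * matDeriv (V j) t) := by
  have h1 := congrArg ((W i t)ᴴ * ·) (h.deriv_mul_V j t)
  simp only [Matrix.mul_add, ← Matrix.mul_assoc,
    conjTranspose_mul_eq_zero_of_blockRow (h.blockRow_W t) hij, Matrix.zero_mul] at h1
  rw [← Matrix.mul_add, h.W_mul, add_zero] at h1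
  rw [← h1, ← Matrix.mul_assoc, ← Matrix.mul_assoc, add_sub_cancel_right]

lemma V_mul_ΔB_mul_W (h : IsAnalyticDecomposition r B ΔB W W' S V) (i j : Fin k) (t : ℝ)
    (hij : i ≠ j) :
    (V i t)ᴴ * (ΔBᴴ * W j t) = ((V i t)ᴴ * matDeriv (V j) t) * (S j t)ᴴ -
      (S i t)ᴴ * ((W i t)ᴴ * matDeriv (W j) t) := by
  have h1 := congrArg ((V i t)ᴴ * ·) (h.deriv_conjTranspose_mul_W j t)
  have h3 : (V i t)ᴴ * (B + (t : ℂ) • ΔB)ᴴ = (S i t)ᴴ * (W i t)ᴴ := by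
    rw [← Matrix.conjTranspose_mul, h.mul_V, Matrix.conjTranspose_mul]
  simp only [Matrix.mul_add] at h1
  rw [← Matrix.mul_assoc _ (V j t), conjTranspose_mul_eq_zero_of_blockRow (h.unitary_V t).1 hij,
    Matrix.zero_mul, add_zero, ← Matrix.mul_assoc _ (B + (t : ℂ) • ΔB)ᴴ, h3, Matrix.mul_assoc,
    ← Matrix.mul_assoc _ (matDeriv (V j) t)] at h1
  rw [← h1, add_sub_cancel_right]

lemma W'_mul_ΔB_mul_V (h : IsAnalyticDecomposition r B ΔB W W' S V) (j : Fin k) (t : ℝ) :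
    (W' t)ᴴ * (ΔB * V j t) = ((W' t)ᴴ * matDeriv (W j) t) * S j t := by
  have h1 := congrArg ((W' t)ᴴ * ·) (h.deriv_mul_V j t)
  simp only [Matrix.mul_add] at h1
  rwa [← Matrix.mul_assoc _ (W j t), h.W'_mul_W, Matrix.zero_mul, add_zero,
    ← Matrix.mul_assoc _ (B + (t : ℂ) • ΔB), h.W'_mul, Matrix.zero_mul, add_zero,
    ← Matrix.mul_assoc _ (matDeriv (W j) t)] at h1

lemma W_mul_ΔB_mul_V_self (h : IsAnalyticDecomposition r B ΔB W W' S V) (j : Fin k) (t : ℝ) :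
    (W j t)ᴴ * (ΔB * V j t) = matDeriv (S j) t := by
  have h1 := congrArg ((W j t)ᴴ * ·) (h.deriv_mul_V j t)
  simp only [Matrix.mul_add] at h1
  rwa [← Matrix.mul_assoc _ (W j t), conjTranspose_mul_eq_one_of_blockRow (h.blockRow_W t),
    Matrix.one_mul, ← Matrix.mul_assoc _ (matDeriv (W j) t), h.normal_W, Matrix.zero_mul, zero_add,
    ← Matrix.mul_assoc _ (B + (t : ℂ) • ΔB), h.W_mul, Matrix.mul_assoc (S j t), h.normal_V,
    Matrix.mul_zero, add_zero] at h1

lemma V_mul_ΔB_mul_W_self (h : IsAnalyticDecomposition r B ΔB W W' S V) (j : Fin k) (t : ℝ) :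
    (V j t)ᴴ * (ΔBᴴ * W j t) = (matDeriv (S j) t)ᴴ := by
  rw [← h.W_mul_ΔB_mul_V_self j t]
  simp [Matrix.conjTranspose_mul, Matrix.mul_assoc]

/-- The differential form of the combined perturbation bound. -/
theorem speed_sq_le (h : IsAnalyticDecomposition r B ΔB W W' S V) (j : Fin k) (t : ℝ) {c d : ℝ}
    (hc : 0 ≤ c) (hcd : c ≤ d)
    (hd : ∀ i, i ≠ j → ∀ p q, d ≤ |singVals (S j t) p - singVals (S i t) q|)
    (hW' : c ^ 2 * frobSq ((W' t)ᴴ * matDeriv (W j) t) ≤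
      frobSq (((W' t)ᴴ * matDeriv (W j) t) * S j t)) :
    2 * frobSq (matDeriv (S j) t) + c ^ 2 * frobSq (matDeriv (W j) t)
      + d ^ 2 * frobSq (matDeriv (V j) t) ≤ frobSq (ΔB * V j t) + frobSq (ΔBᴴ * W j t) := by
  rw [frobSq_eq_sum_of_fromCols (h.unitary_W t) (ΔB * V j t),
    frobSq_eq_sum_of_blockRow (h.unitary_V t) (ΔBᴴ * W j t),
    frobSq_eq_sum_of_fromCols (h.unitary_W t) (matDeriv (W j) t),
    frobSq_eq_sum_of_blockRow (h.unitary_V t) (matDeriv (V j) t), h.W'_mul_ΔB_mul_V]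
  have hcd2 : c ^ 2 ≤ d ^ 2 := pow_le_pow_left₀ hc hcd 2
  -- At `i = j` both projections contribute `‖Σ̇_j‖²`, whence the factor 2. Off the diagonal the gap
  -- gives weight `d²` on both unknowns; on `W` it is lowered to `c²`, the weight available in the
  -- last block.
  have key : ∀ i, (if i = j then 2 * frobSq (matDeriv (S j) t) else 0)
      + c ^ 2 * frobSq ((W i t)ᴴ * matDeriv (W j) t) + d ^ 2 * frobSq ((V i t)ᴴ * matDeriv (V j) t)
      ≤ frobSq ((W i t)ᴴ * (ΔB * V j t)) + frobSq ((V i t)ᴴ * (ΔBᴴ * W j t)) := by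
    intro i
    by_cases hij : i = j
    · subst hij
      rw [h.W_mul_ΔB_mul_V_self, h.V_mul_ΔB_mul_W_self, frobSq_conjTranspose, h.normal_W,
        h.normal_V]
      simp [frobSq, two_mul]
    · rw [h.W_mul_ΔB_mul_V i j t hij, h.V_mul_ΔB_mul_W i j t hij, if_neg hij]
      have h1 := gap_sq_mul_frobSq_le (hc.trans hcd) (S j t) (S i t) (hd i hij)
        ((W i t)ᴴ * matDeriv (W j) t) ((V i t)ᴴ * matDeriv (V j) t)
      have h2 := mul_le_mul_of_nonneg_right hcd2 (frobSq_nonneg ((W i t)ᴴ * matDeriv (W j) t))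
      linarith
  have hs := Finset.sum_le_sum fun i (_ : i ∈ Finset.univ) => key i
  simp only [Finset.sum_add_distrib, ← Finset.mul_sum, Finset.sum_ite_eq', Finset.mem_univ,
    if_true] at hs
  linarith

end IsAnalyticDecomposition

/-! ### Matrices as Euclidean vectors -/

section Vec

variable {ι κ l : Type*}

/-- The entries of a matrix as a vector of a Euclidean space. -/
def vec (M : Matrix ι κ ℂ) : EuclideanSpace ℂ (ι × κ) := WithLp.toLp 2 fun p => M p.1 p.2

lemma vec_sub (M N : Matrix ι κ ℂ) : vec (M - N) = vec M - vec N := rfl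

lemma continuous_vec {F : ℝ → Matrix ι κ ℂ} (h : ∀ a b, Continuous fun t => F t a b) :
    Continuous fun t => vec (F t) :=
  (PiLp.continuous_toLp 2 _).comp (continuous_pi fun p => h p.1 p.2)

variable [Fintype ι] [Fintype κ] [Fintype l]

lemma norm_vec_sq (M : Matrix ι κ ℂ) : ‖vec M‖ ^ 2 = frobSq M := by
  rw [EuclideanSpace.norm_sq_eq, frobSq, Fintype.sum_prod_type]
  rfl

lemma frobSq_fromRows (A : Matrix ι κ ℂ) (B : Matrix l κ ℂ) :
    frobSq (Matrix.fromRows A B) = frobSq A + frobSq B := by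
  rw [frobSq, Fintype.sum_sum_type]
  rfl

lemma frobSq_smul (c : ℂ) (A : Matrix ι κ ℂ) : frobSq (c • A) = ‖c‖ ^ 2 * frobSq A := by
  simp only [frobSq, Matrix.smul_apply, norm_smul, mul_pow, Finset.mul_sum]

lemma HasMatDerivAt.hasDerivAt_vec {F : ℝ → Matrix ι κ ℂ} {F' : Matrix ι κ ℂ} {t : ℝ}
    (h : HasMatDerivAt F F' t) : HasDerivAt (fun s => vec (F s)) (vec F') t := by
  have h1 : HasDerivAt (fun s (p : ι × κ) => F s p.1 p.2) (fun p => F' p.1 p.2) t :=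
    hasDerivAt_pi.mpr fun p => h p.1 p.2
  exact ((PiLp.continuousLinearEquiv 2 ℝ fun _ : ι × κ => ℂ).symm.toContinuousLinearMap.hasFDerivAt
    |>.comp_hasDerivAt t h1)

end Vec

/-! ### From speed to displacement -/

namespace IsAnalyticDecomposition

variable {m n k : ℕ} {r : Fin k → ℕ} {B ΔB : Matrix (Fin m) (Fin n) ℂ}
  {W : (j : Fin k) → ℝ → Matrix (Fin m) (Fin (r j)) ℂ}
  {W' : ℝ → Matrix (Fin m) (Fin (m - n)) ℂ}
  {S : (j : Fin k) → ℝ → Matrix (Fin (r j)) (Fin (r j)) ℂ}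
  {V : (j : Fin k) → ℝ → Matrix (Fin n) (Fin (r j)) ℂ}

open scoped Matrix.Norms.L2Operator in
/-- The combined perturbation bound in real form, for any lower bounds `c ≤ d` on the gaps. -/
theorem displacement_sq_le (h : IsAnalyticDecomposition r B ΔB W W' S V) (j : Fin k) {c d : ℝ}
    (hx : ‖ΔB‖ < c) (hcd : c ≤ d)
    (hd : ∀ t ∈ Set.Icc (0 : ℝ) 1, ∀ i, i ≠ j → ∀ p q,
      d ≤ |singVals (S j t) p - singVals (S i t) q|)
    (hW' : ∀ t ∈ Set.Icc (0 : ℝ) 1, c ^ 2 * frobSq ((W' t)ᴴ * matDeriv (W j) t) ≤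
      frobSq (((W' t)ᴴ * matDeriv (W j) t) * S j t)) :
    2 * frobSq (S j 1 - S j 0) + c ^ 2 * frobSq (W j 1 - W j 0) + d ^ 2 * frobSq (V j 1 - V j 0) ≤
      (c / (c - ‖ΔB‖)) ^ 2 * (frobSq (ΔB * V j 0) + frobSq (ΔBᴴ * W j 0)) := by
  set x := ‖ΔB‖ with hxdef
  have hx0 : 0 ≤ x := norm_nonneg _
  have hc : 0 < c := hx0.trans_lt hx
  have hd0 : 0 < d := hc.trans_le hcd
  -- The weights `√2, c, d` make the left side of the speed estimate the squared speed of a single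
  -- curve.
  let comb (X : Matrix (Fin (r j)) (Fin (r j)) ℂ) (Y : Matrix (Fin m) (Fin (r j)) ℂ)
      (Z : Matrix (Fin n) (Fin (r j)) ℂ) :=
    Matrix.fromRows ((√2 : ℂ) • X) (Matrix.fromRows ((c : ℂ) • Y) ((d : ℂ) • Z))
  have hcomb : ∀ X Y Z, frobSq (comb X Y Z) = 2 * frobSq X + c ^ 2 * frobSq Y + d ^ 2 * frobSq Z := by
    intro X Y Z
    simp only [comb, frobSq_fromRows, frobSq_smul, Complex.norm_real, Real.norm_eq_abs, sq_abs]
    rw [Real.sq_sqrt (by norm_num)]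
    ring
  have hcomb_sub : ∀ X Y Z X' Y' Z', comb X Y Z - comb X' Y' Z' =
      comb (X - X') (Y - Y') (Z - Z') := by
    intro X Y Z X' Y' Z'
    ext (a | a | a) b <;> simp [comb, mul_sub]
  set Z : ℝ → _ := fun t => comb (S j t) (W j t) (V j t) with hZ
  set Z' : ℝ → _ := fun t => comb (matDeriv (S j) t) (matDeriv (W j) t) (matDeriv (V j) t) with hZ'
  set H : ℝ → _ := fun t => Matrix.fromRows (ΔB * V j t) (ΔBᴴ * W j t) with hH
  have hHsq : ∀ t, frobSq (H t) = frobSq (ΔB * V j t) + frobSq (ΔBᴴ * W j t) :=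
    fun t => frobSq_fromRows _ _
  have hder : ∀ t, HasDerivAt (fun s => vec (Z s)) (vec (Z' t)) t := fun t =>
    (((h.analytic_S j).hasMatDerivAt t).const_smul _ |>.fromRows
      ((((h.analytic_W j).hasMatDerivAt t).const_smul _).fromRows
        (((h.analytic_V j).hasMatDerivAt t).const_smul _))).hasDerivAt_vec
  have hcont : Continuous fun t => ‖vec (Z' t)‖ := by
    refine (continuous_vec ?_).norm
    rintro (a | a | a) b
    · exact continuous_const.mul ((h.analytic_S j).continuous_matDeriv a b)
    · exact continuous_const.mul ((h.analytic_W j).continuous_matDeriv a b)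
    · exact continuous_const.mul ((h.analytic_V j).continuous_matDeriv a b)
  obtain ⟨t₀, ht₀, hmax⟩ := isCompact_Icc.exists_isMaxOn
    (Set.nonempty_Icc.mpr (zero_le_one (α := ℝ))) hcont.continuousOn
  set M := ‖vec (Z' t₀)‖ with hM
  have hM0 : 0 ≤ M := norm_nonneg _
  have hdisp : ∀ t ∈ Set.Icc (0 : ℝ) 1, ‖vec (Z t) - vec (Z 0)‖ ≤ M := by
    intro t ht
    refine (norm_image_sub_le_of_norm_deriv_le_segment' (C := M)
      (fun s _ => (hder s).hasDerivWithinAt)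
      (fun s hs => hmax (Set.Ico_subset_Icc_self hs)) t ht).trans ?_
    rw [sub_zero]
    exact mul_le_of_le_one_right hM0 ht.2
  have hspeed : M ≤ ‖vec (H t₀)‖ := by
    refine le_of_sq_le_sq ?_ (norm_nonneg _)
    rw [hM, norm_vec_sq, norm_vec_sq, hHsq, hZ', hcomb]
    exact h.speed_sq_le j t₀ hc.le hcd (hd t₀ ht₀) (hW' t₀ ht₀)
  -- Only the `W` and `V` components of the curve enter `H`; each carries weight at least `c`, and
  -- `ΔB` and its adjoint enlarge Frobenius norms by at most the factor `x`.
  have hHdiff : c * ‖vec (H t₀) - vec (H 0)‖ ≤ x * M := by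
    refine le_of_sq_le_sq ?_ (by positivity)
    have e1 : H t₀ - H 0 = Matrix.fromRows (ΔB * (V j t₀ - V j 0)) (ΔBᴴ * (W j t₀ - W j 0)) := by
      ext (a | a) b <;> simp [hH, Matrix.mul_sub]
    have e2 := frobSq_mul_le ΔB (V j t₀ - V j 0)
    have e3 := frobSq_mul_le ΔBᴴ (W j t₀ - W j 0)
    rw [Matrix.l2_opNorm_conjTranspose, ← hxdef] at e3
    rw [← hxdef] at e2
    have e4 := pow_le_pow_left₀ (norm_nonneg _) (hdisp t₀ ht₀) 2
    rw [← vec_sub, norm_vec_sq, hZ, hcomb_sub, hcomb] at e4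
    rw [mul_pow, mul_pow, ← vec_sub, norm_vec_sq, e1, frobSq_fromRows]
    have e5 := frobSq_nonneg (S j t₀ - S j 0)
    have e6 := mul_le_mul_of_nonneg_right (pow_le_pow_left₀ hc.le hcd 2)
      (frobSq_nonneg (V j t₀ - V j 0))
    calc c ^ 2 * (frobSq (ΔB * (V j t₀ - V j 0)) + frobSq (ΔBᴴ * (W j t₀ - W j 0)))
        ≤ c ^ 2 * (x ^ 2 * frobSq (V j t₀ - V j 0) + x ^ 2 * frobSq (W j t₀ - W j 0)) := by
          gcongr
      _ = x ^ 2 * (c ^ 2 * frobSq (V j t₀ - V j 0) + c ^ 2 * frobSq (W j t₀ - W j 0)) := by ring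
      _ ≤ x ^ 2 * M ^ 2 := by
          refine mul_le_mul_of_nonneg_left ?_ (by positivity)
          linarith
  -- The bound on `M` involves `M` itself with factor `x / c < 1`, so it can be absorbed.
  have hbound : M ≤ c / (c - x) * ‖vec (H 0)‖ := by
    have htri : ‖vec (H t₀)‖ ≤ ‖vec (H t₀) - vec (H 0)‖ + ‖vec (H 0)‖ := by
      simpa using norm_add_le (vec (H t₀) - vec (H 0)) (vec (H 0))
    rw [div_mul_eq_mul_div, le_div_iff₀ (sub_pos.mpr hx)]
    have := mul_le_mul_of_nonneg_left (hspeed.trans htri) hc.le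
    linarith
  have hfin := pow_le_pow_left₀ (norm_nonneg _)
    ((hdisp 1 (Set.right_mem_Icc.mpr zero_le_one)).trans hbound) 2
  rwa [mul_pow, norm_vec_sq, hHsq, ← vec_sub, norm_vec_sq, hZ, hcomb_sub,
    hcomb] at hfin

end IsAnalyticDecomposition

/-! ### From extended gaps to real bounds -/

section Gaps

variable {k : ℕ} {r : Fin k → ℕ} {S : (j : Fin k) → ℝ → Matrix (Fin (r j)) (Fin (r j)) ℂ}
  {j : Fin k}

lemma le_abs_singVals_sub_of_le_rhoMin {d : ℝ} (h : ENNReal.ofReal d ≤ rhoMin S j) :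
    ∀ t ∈ Set.Icc (0 : ℝ) 1, ∀ i, i ≠ j → ∀ p q,
      d ≤ |singVals (S j t) p - singVals (S i t) q| := by
  simp only [rhoMin, rho, rhoPair, le_iInf_iff] at h
  intro t ht i hi p q
  exact (ENNReal.ofReal_le_ofReal_iff (abs_nonneg _)).mp (h t ht i hi p q)

lemma le_singVals_of_le_rhoHatMin {c : ℝ} (h : ENNReal.ofReal c ≤ rhoHatMin S j) :
    ∀ t ∈ Set.Icc (0 : ℝ) 1, ∀ p, c ≤ singVals (S j t) p := by
  simp only [rhoHatMin, rhoHat, sigmaMin, le_iInf_iff, le_min_iff] at h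
  intro t ht p
  exact (ENNReal.ofReal_le_ofReal_iff (singVals_nonneg _ _)).mp ((h t ht).2 p)

lemma rhoHatMin_le_rhoMin : rhoHatMin S j ≤ rhoMin S j :=
  iInf₂_mono fun _ _ => min_le_left _ _

lemma rhoHatMin_ne_top (p : Fin (r j)) : rhoHatMin S j ≠ ⊤ := by
  refine ne_top_of_le_ne_top ENNReal.ofReal_ne_top
    (b := ENNReal.ofReal (singVals (S j 0) p)) ?_
  exact (iInf₂_le (0 : ℝ) (Set.left_mem_Icc.mpr zero_le_one)).trans
    ((min_le_right _ _).trans (iInf_le _ p))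

end Gaps

/-- If `v > 0`, the chosen `d` gives `d² v ≥ d v ≥ K + v > K`. Applied when the gap is infinite, it
makes the terms with coefficient `∞` vanish. -/
lemma eq_zero_of_forall_sq_mul_le {v K c : ℝ} (hv : 0 ≤ v) (h : ∀ d, c ≤ d → d ^ 2 * v ≤ K) :
    v = 0 := by
  by_contra hne
  have hv' : 0 < v := lt_of_le_of_ne hv (Ne.symm hne)
  set d := max c (max 1 (K / v + 1)) with hd
  have h1 : 1 ≤ d := (le_max_left _ _).trans (le_max_right _ _)
  have h2 : K / v + 1 ≤ d := (le_max_right _ _).trans (le_max_right _ _)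
  have h3 := h d (le_max_left _ _)
  have h4 : (K / v + 1) * v ≤ d * v := mul_le_mul_of_nonneg_right h2 hv
  rw [add_mul, div_mul_cancel₀ _ hne] at h4
  have h5 : d * v ≤ d ^ 2 * v := mul_le_mul_of_nonneg_right (le_self_pow₀ h1 two_ne_zero) hv
  linarith

/-! ### The bounds in extended nonnegative reals -/

section Main

variable {m n k : ℕ} {r : Fin k → ℕ} {B ΔB : Matrix (Fin m) (Fin n) ℂ}
  {W : (j : Fin k) → ℝ → Matrix (Fin m) (Fin (r j)) ℂ}
  {W' : ℝ → Matrix (Fin m) (Fin (m - n)) ℂ}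
  {S : (j : Fin k) → ℝ → Matrix (Fin (r j)) (Fin (r j)) ℂ}
  {V : (j : Fin k) → ℝ → Matrix (Fin n) (Fin (r j)) ℂ}

open scoped Matrix.Norms.L2Operator in
lemma specNorm_eq (A : Matrix (Fin m) (Fin n) ℂ) : specNorm A = ENNReal.ofReal ‖A‖ :=
  (ofReal_norm A).symm

lemma frobNorm_conjTranspose_mul_sq {l : ℕ} (X : Matrix (Fin m) (Fin l) ℂ)
    (A : Matrix (Fin m) (Fin n) ℂ) :
    frobNorm (Xᴴ * A) ^ 2 = ENNReal.ofReal (frobSq (Aᴴ * X)) := by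
  rw [frobNorm_sq, ← frobSq_conjTranspose]
  simp

open scoped Matrix.Norms.L2Operator in
theorem IsAnalyticDecomposition.singDown_displacement_sq_le
    (h : IsAnalyticDecomposition r B ΔB W W' S V) (j : Fin k) {c d : ℝ}
    (hx : ‖ΔB‖ < c) (hcd : c ≤ d) (hd : ENNReal.ofReal d ≤ rhoMin S j)
    (hW' : ∀ t ∈ Set.Icc (0 : ℝ) 1, c ^ 2 * frobSq ((W' t)ᴴ * matDeriv (W j) t) ≤
      frobSq (((W' t)ᴴ * matDeriv (W j) t) * S j t)) :
    2 * frobSq (singDown (S j 1) - singDown (S j 0)) + c ^ 2 * frobSq (W j 1 - W j 0)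
        + d ^ 2 * frobSq (V j 1 - V j 0) ≤
      (c / (c - ‖ΔB‖)) ^ 2 * (frobSq (ΔB * V j 0) + frobSq (ΔBᴴ * W j 0)) := by
  have h1 := h.displacement_sq_le j hx hcd (le_abs_singVals_sub_of_le_rhoMin hd) hW'
  have h2 := frobSq_singDown_sub_le (S j 1) (S j 0)
  linarith

theorem IsAnalyticDecomposition.combined_bound (h : IsAnalyticDecomposition r B ΔB W W' S V)
    (j : Fin k) (hlt : specNorm ΔB < rhoHatMin S j) :
    2 * frobNorm (singDown (S j 1) - singDown (S j 0)) ^ 2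
        + rhoHatMin S j ^ 2 * frobNorm (W j 1 - W j 0) ^ 2
        + rhoMin S j ^ 2 * frobNorm (V j 1 - V j 0) ^ 2
      ≤ (rhoHatMin S j / (rhoHatMin S j - specNorm ΔB)) ^ 2
          * (frobNorm (ΔB * V j 0) ^ 2 + frobNorm ((W j 0)ᴴ * ΔB) ^ 2) := by
  -- An empty block makes all norms zero; otherwise `ρ̂_min` is finite, being at most a singular
  -- value.
  rcases isEmpty_or_nonempty (Fin (r j)) with he | ⟨⟨p⟩⟩
  · simp [frobNorm_sq, frobSq]
  have htop : rhoHatMin S j ≠ ⊤ := rhoHatMin_ne_top p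
  rw [frobNorm_conjTranspose_mul_sq]
  simp only [frobNorm_sq]
  set c := (rhoHatMin S j).toReal with hc
  have hc' : rhoHatMin S j = ENNReal.ofReal c := (ENNReal.ofReal_toReal htop).symm
  rw [specNorm_eq] at hlt ⊢
  open scoped Matrix.Norms.L2Operator in
  set x := ‖ΔB‖ with hxdef
  have hx0 : 0 ≤ x := by open scoped Matrix.Norms.L2Operator in exact norm_nonneg _
  have hxc : x < c := by
    rw [hc'] at hlt
    exact (ENNReal.ofReal_lt_ofReal_iff_of_nonneg hx0).mp hlt
  have hc0 : 0 < c := hx0.trans_lt hxc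
  have hW' : ∀ t ∈ Set.Icc (0 : ℝ) 1, c ^ 2 * frobSq ((W' t)ᴴ * matDeriv (W j) t) ≤
      frobSq (((W' t)ᴴ * matDeriv (W j) t) * S j t) := fun t ht =>
    sq_mul_frobSq_le_of_le_singVals hc0.le _ (le_singVals_of_le_rhoHatMin hc'.ge t ht) _
  -- The constant `d` stays free: it is `ρ_min` when that is finite and arbitrarily large otherwise.
  have hreal := fun d hcd hd => h.singDown_displacement_sq_le (c := c) (d := d) j hxc hcd hd hW'
  rw [← hxdef] at hreal
  have hs := frobSq_nonneg (singDown (S j 1) - singDown (S j 0))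
  have hw := frobSq_nonneg (W j 1 - W j 0)
  have hv := frobSq_nonneg (V j 1 - V j 0)
  have hR1 := frobSq_nonneg (ΔB * V j 0)
  have hR2 := frobSq_nonneg (ΔBᴴ * W j 0)
  have hrhs : (rhoHatMin S j / (rhoHatMin S j - ENNReal.ofReal x)) ^ 2 *
      (ENNReal.ofReal (frobSq (ΔB * V j 0)) + ENNReal.ofReal (frobSq (ΔBᴴ * W j 0))) =
      ENNReal.ofReal ((c / (c - x)) ^ 2 * (frobSq (ΔB * V j 0) + frobSq (ΔBᴴ * W j 0))) := by
    have hcx : 0 < c - x := sub_pos.mpr hxc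
    rw [hc', ← ENNReal.ofReal_sub _ hx0, ← ENNReal.ofReal_div_of_pos hcx,
      ← ENNReal.ofReal_pow (by positivity), ← ENNReal.ofReal_add hR1 hR2,
      ← ENNReal.ofReal_mul (by positivity)]
  have hlhs : ∀ d, 0 ≤ d → 2 * ENNReal.ofReal (frobSq (singDown (S j 1) - singDown (S j 0)))
      + ENNReal.ofReal c ^ 2 * ENNReal.ofReal (frobSq (W j 1 - W j 0))
      + ENNReal.ofReal d ^ 2 * ENNReal.ofReal (frobSq (V j 1 - V j 0)) =
      ENNReal.ofReal (2 * frobSq (singDown (S j 1) - singDown (S j 0))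
        + c ^ 2 * frobSq (W j 1 - W j 0) + d ^ 2 * frobSq (V j 1 - V j 0)) := by
    intro d hd
    rw [ENNReal.ofReal_add (by positivity) (by positivity),
      ENNReal.ofReal_add (by positivity) (by positivity), ENNReal.ofReal_mul (by positivity),
      ENNReal.ofReal_mul (by positivity), ENNReal.ofReal_mul (by positivity),
      ENNReal.ofReal_pow hc0.le, ENNReal.ofReal_pow hd, ENNReal.ofReal_ofNat]
  rw [hrhs]
  by_cases hrho : rhoMin S j = ⊤
  · have hv0 : frobSq (V j 1 - V j 0) = 0 :=
      eq_zero_of_forall_sq_mul_le (c := c)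
          (K := (c / (c - x)) ^ 2 * (frobSq (ΔB * V j 0) + frobSq (ΔBᴴ * W j 0))) hv
          fun d hcd => by
        have h1 := hreal d hcd (by rw [hrho]; exact le_top)
        have h2 : 0 ≤ c ^ 2 * frobSq (W j 1 - W j 0) := by positivity
        linarith
    have h1 := hreal c le_rfl (by rw [hrho]; exact le_top)
    have h2 := hlhs c hc0.le
    rw [hv0] at h2 ⊢
    simp only [ENNReal.ofReal_zero, mul_zero] at h2 ⊢
    rw [hc', h2]
    rw [hv0, mul_zero] at h1
    exact ENNReal.ofReal_le_ofReal h1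
  · set d := (rhoMin S j).toReal with hd
    have hd' : rhoMin S j = ENNReal.ofReal d := (ENNReal.ofReal_toReal hrho).symm
    have hcd : c ≤ d := ENNReal.toReal_mono hrho rhoHatMin_le_rhoMin
    rw [hc', hd', hlhs d (hc0.le.trans hcd)]
    exact ENNReal.ofReal_le_ofReal (hreal d hcd hd'.ge)

theorem IsAnalyticDecomposition.combined_bound_of_square
    (h : IsAnalyticDecomposition r B ΔB W W' S V) (j : Fin k) (hmn : m = n)
    (hlt : specNorm ΔB < rhoMin S j) :
    2 * (1 - specNorm ΔB / rhoMin S j) ^ 2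
          * frobNorm (singDown (S j 1) - singDown (S j 0)) ^ 2
        + (rhoMin S j - specNorm ΔB) ^ 2
          * (frobNorm (W j 1 - W j 0) ^ 2 + frobNorm (V j 1 - V j 0) ^ 2)
      ≤ frobNorm (ΔB * V j 0) ^ 2 + frobNorm ((W j 0)ᴴ * ΔB) ^ 2 := by
  rw [frobNorm_conjTranspose_mul_sq]
  simp only [frobNorm_sq]
  rw [specNorm_eq] at hlt ⊢
  open scoped Matrix.Norms.L2Operator in
  set x := ‖ΔB‖ with hxdef
  have hx0 : 0 ≤ x := by open scoped Matrix.Norms.L2Operator in exact norm_nonneg _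
  have : IsEmpty (Fin (m - n)) := by
    rw [hmn, Nat.sub_self]; infer_instance
  have hs := frobSq_nonneg (singDown (S j 1) - singDown (S j 0))
  have hw := frobSq_nonneg (W j 1 - W j 0)
  have hv := frobSq_nonneg (V j 1 - V j 0)
  have hR1 := frobSq_nonneg (ΔB * V j 0)
  have hR2 := frobSq_nonneg (ΔBᴴ * W j 0)
  set s := frobSq (singDown (S j 1) - singDown (S j 0))
  set w := frobSq (W j 1 - W j 0) with hwdef
  set v := frobSq (V j 1 - V j 0) with hvdef
  set R₁ := frobSq (ΔB * V j 0)
  set R₂ := frobSq (ΔBᴴ * W j 0)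
  -- The last block of `W` has no columns, so its condition holds for every `c` and `d = c` is
  -- allowed. The estimate is then multiplied by `((c - x) / c)²`.
  have hreal : ∀ c, x < c → ENNReal.ofReal c ≤ rhoMin S j →
      2 * (1 - x / c) ^ 2 * s + (c - x) ^ 2 * (w + v) ≤ R₁ + R₂ := by
    intro c hxc hcr
    have h1 := h.singDown_displacement_sq_le (c := c) (d := c) j hxc le_rfl hcr
      (fun t _ => by simp [frobSq])
    rw [← hxdef, ← hwdef, ← hvdef] at h1
    have hc0 : 0 < c := hx0.trans_lt hxc
    have hcx : 0 < c - x := sub_pos.mpr hxc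
    have h2 := mul_le_mul_of_nonneg_left h1 (sq_nonneg ((c - x) / c))
    have e1 : ((c - x) / c) ^ 2 * ((c / (c - x)) ^ 2 * (R₁ + R₂)) = R₁ + R₂ := by
      field_simp
    have e2 : ((c - x) / c) ^ 2 * (2 * s + c ^ 2 * w + c ^ 2 * v) =
        2 * (1 - x / c) ^ 2 * s + (c - x) ^ 2 * (w + v) := by
      field_simp
      ring
    rw [← e1, ← e2]
    exact h2
  by_cases hrho : rhoMin S j = ⊤
  -- Taking `c = x + d` turns the coefficient `(c - x)²` into `d²`, with `d ≥ 1` ensuring `x < c`.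
  · have hwv : w + v = 0 := eq_zero_of_forall_sq_mul_le (c := 1) (K := R₁ + R₂)
        (add_nonneg hw hv) fun d hd => by
      have h1 := hreal (x + d) (by linarith) (by rw [hrho]; exact le_top)
      rw [add_sub_cancel_left] at h1
      have h2 : 0 ≤ 2 * (1 - x / (x + d)) ^ 2 * s := by positivity
      linarith
    have hw0 : w = 0 := by linarith
    have hv0 : v = 0 := by linarith
    -- The singular value term survives an infinite gap; its sharp coefficient 2 is the limit as `c
    -- → ∞`.
    have hlim : Filter.Tendsto (fun c : ℝ => 2 * (1 - x / c) ^ 2 * s) Filter.atTop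
        (nhds (2 * (1 - 0) ^ 2 * s)) :=
      (((tendsto_const_nhds.sub (Filter.tendsto_id.const_div_atTop x)).pow 2).const_mul 2).mul_const s
    have hle : 2 * (1 - 0) ^ 2 * s ≤ R₁ + R₂ := by
      refine le_of_tendsto hlim ?_
      filter_upwards [Filter.eventually_gt_atTop x] with c hc
      have h1 := hreal c hc (by rw [hrho]; exact le_top)
      rwa [hwv, mul_zero, add_zero] at h1
    rw [hrho, hw0, hv0]
    simp only [ENNReal.div_top, tsub_zero, one_pow, mul_one, ENNReal.ofReal_zero, add_zero,
      mul_zero]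
    rw [← ENNReal.ofReal_add hR1 hR2, ← ENNReal.ofReal_ofNat 2,
      ← ENNReal.ofReal_mul (by norm_num)]
    exact ENNReal.ofReal_le_ofReal (by linarith)
  · set c := (rhoMin S j).toReal with hc
    have hc' : rhoMin S j = ENNReal.ofReal c := (ENNReal.ofReal_toReal hrho).symm
    have hxc : x < c := by
      rw [hc'] at hlt
      exact (ENNReal.ofReal_lt_ofReal_iff_of_nonneg hx0).mp hlt
    have hc0 : 0 < c := hx0.trans_lt hxc
    have hcx : 0 < c - x := sub_pos.mpr hxc
    have h1x : 0 ≤ 1 - x / c := by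
      rw [sub_nonneg, div_le_one hc0]; exact hxc.le
    have h1 := hreal c hxc hc'.ge
    rw [hc', ← ENNReal.ofReal_sub _ hx0, ← ENNReal.ofReal_div_of_pos hc0, ← ENNReal.ofReal_one,
      ← ENNReal.ofReal_sub _ (by positivity), ← ENNReal.ofReal_pow h1x,
      ← ENNReal.ofReal_pow hcx.le, ← ENNReal.ofReal_ofNat 2, ← ENNReal.ofReal_mul (by norm_num),
      ← ENNReal.ofReal_mul (by positivity), ← ENNReal.ofReal_add hw hv,
      ← ENNReal.ofReal_mul (by positivity), ← ENNReal.ofReal_add hR1 hR2,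
      ← ENNReal.ofReal_add (by positivity) (by positivity)]
    exact ENNReal.ofReal_le_ofReal h1

end Main

end CombinedSVD

end

theorem mainTheorem5 {m n k : ℕ} [NeZero k] (hmn : n ≤ m)
    (r : Fin k → ℕ) (hr : ∑ j, r j = n)
    (B ΔB : Matrix (Fin m) (Fin n) ℂ)
    (W : (j : Fin k) → ℝ → Matrix (Fin m) (Fin (r j)) ℂ)
    (W' : ℝ → Matrix (Fin m) (Fin (m - n)) ℂ)
    (S : (j : Fin k) → ℝ → Matrix (Fin (r j)) (Fin (r j)) ℂ)
    (V : (j : Fin k) → ℝ → Matrix (Fin n) (Fin (r j)) ℂ)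
    (hdec : CombinedSVD.IsAnalyticDecomposition r B ΔB W W' S V) :
    (CombinedSVD.specNorm ΔB < CombinedSVD.rhoHatMin S 0 →
      2 * CombinedSVD.frobNorm
            (CombinedSVD.singDown (S 0 1) - CombinedSVD.singDown (S 0 0)) ^ 2
        + CombinedSVD.rhoHatMin S 0 ^ 2 * CombinedSVD.frobNorm (W 0 1 - W 0 0) ^ 2
        + CombinedSVD.rhoMin S 0 ^ 2 * CombinedSVD.frobNorm (V 0 1 - V 0 0) ^ 2
      ≤ (CombinedSVD.rhoHatMin S 0 /
            (CombinedSVD.rhoHatMin S 0 - CombinedSVD.specNorm ΔB)) ^ 2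
          * (CombinedSVD.frobNorm (ΔB * V 0 0) ^ 2
              + CombinedSVD.frobNorm ((W 0 0)ᴴ * ΔB) ^ 2)) ∧
    (m = n → CombinedSVD.specNorm ΔB < CombinedSVD.rhoMin S 0 →
      2 * (1 - CombinedSVD.specNorm ΔB / CombinedSVD.rhoMin S 0) ^ 2
          * CombinedSVD.frobNorm
              (CombinedSVD.singDown (S 0 1) - CombinedSVD.singDown (S 0 0)) ^ 2
        + (CombinedSVD.rhoMin S 0 - CombinedSVD.specNorm ΔB) ^ 2
          * (CombinedSVD.frobNorm (W 0 1 - W 0 0) ^ 2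
              + CombinedSVD.frobNorm (V 0 1 - V 0 0) ^ 2)
      ≤ CombinedSVD.frobNorm (ΔB * V 0 0) ^ 2
          + CombinedSVD.frobNorm ((W 0 0)ᴴ * ΔB) ^ 2) := by
  exact ⟨hdec.combined_bound 0, hdec.combined_bound_of_square 0⟩
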